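/- Fix $d\in\mathbb{N}$. Let $X_1,X_2,\dots$ be i.i.d. random vectors in the Euclidean space $\mathbb{R}^d$, defined on a probability space $(\Omega,\mathcal{A},\mathbb{P})$, with $\mathbb{E}[X_1]=0$ and $\mathbb{E}[\|X_1\|^2]<\infty$, and assume that $X_1$ is not almost surely equal to $0$ (equivalently, $\operatorname{Cov}(X_1)\neq 0$). Put $\overline{X}_n=n^{-1}\sum_{i=1}^n X_i$ and $V_n=n\|\overline{X}_n\|^2$. Let $(\Omega^*,\mathcal{A}^*,\mathbb{P}^*)$ be a probability space carrying, for every $n$, random variables $i_{n1},\dots,i_{nn}$ which are $\mathbb{P}^*$-independent and uniformly distributed on $\{1,\dots,n\}$. For $\omega\in\Omega$ define on $\Omega^*$ the bootstrap observations $\xi_{nk}(\omega)(\omega^*)=X_{i_{nk}(\omega^*)}(\omega)$, $1\le k\le n$, and the bootstrap statistic $$V_n^*(\omega)=n\Big\|\frac1n\sum_{k=1}^n\big(\xi_{nk}(\omega)-\overline{X}_n(\omega)\big)\Big\|^2 .$$ Let $F_n^*(\omega)(x)=\mathbb{P}^*(V_n^*(\omega)\le x)$ be its distribution function, and for $\alpha\in(0,1)$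 let $$c^*_{n,\alpha}(\omega)=\inf\{x\in\mathbb{R}: F_n^*(\omega)(x)\ge 1-\alpha\}$$ be its $(1-\alpha)$-quantile. Then for each $\alpha\in(0,1)$ the test that rejects $H_0:\mathbb{E}[X_1]=0$ when $V_n>c^*_{n,\alpha}$ has asymptotic level $\alpha$: $$\mathbb{P}\big(V_n>c^*_{n,\alpha}\big)\longrightarrow\alpha\qquad(n\to\infty).$$ -/

import Mathlib

open MeasureTheory ProbabilityTheory Filter Topology

noncomputable section

namespace BootstrapMeanTest

variable {Ω Ω' E : Type*} [NormedAddCommGroup E] [NormedSpace ℝ E]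

/-- The arithmetic mean of the first `n` observations. The sample `X 0, X 1, …` is indexed from
zero, so the first `n` observations are `X 0, …, X (n - 1)`. -/
def sampleMean (X : ℕ → Ω → E) (n : ℕ) (ω : Ω) : E :=
  (n : ℝ)⁻¹ • ∑ k : Fin n, X k ω

/-- The test statistic: `n` times the squared norm of the sample mean. -/
def testStat (X : ℕ → Ω → E) (n : ℕ) (ω : Ω) : ℝ :=
  (n : ℝ) * ‖sampleMean X n ω‖ ^ 2

/-- For fixed data point `ω`, the `k`-th bootstrap observation of the `n`-th row, obtained from
the resampling indices `I n k`. It is a random variable on the resampling space `Ω'`. -/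
def bootObs (X : ℕ → Ω → E) (I : (n : ℕ) → Fin n → Ω' → Fin n) (n : ℕ) (k : Fin n)
    (ω : Ω) (ω' : Ω') : E :=
  X (I n k ω') ω

/-- The bootstrap version of the test statistic: `n` times the squared norm of the mean of the
bootstrap observations centered at the sample mean. -/
def bootStat (X : ℕ → Ω → E) (I : (n : ℕ) → Fin n → Ω' → Fin n) (n : ℕ)
    (ω : Ω) (ω' : Ω') : ℝ :=
  (n : ℝ) * ‖(n : ℝ)⁻¹ • ∑ k : Fin n, (bootObs X I n k ω ω' - sampleMean X n ω)‖ ^ 2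

/-- The distribution function, under the resampling measure `P'`, of the bootstrap statistic for
fixed data point `ω`. -/
def bootCdf [MeasurableSpace Ω'] (P' : Measure Ω') (X : ℕ → Ω → E)
    (I : (n : ℕ) → Fin n → Ω' → Fin n) (n : ℕ) (ω : Ω) (x : ℝ) : ℝ :=
  P'.real {ω' | bootStat X I n ω ω' ≤ x}

/-- The quantile function (generalized left inverse) of a distribution function `F`. -/
def quantile (F : ℝ → ℝ) (u : ℝ) : ℝ :=
  sInf {x : ℝ | u ≤ F x}

/-- The bootstrap critical value: the `(1 - α)`-quantile of the bootstrap distribution. It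
depends on the data point `ω`. -/
def bootQuantile [MeasurableSpace Ω'] (P' : Measure Ω') (X : ℕ → Ω → E)
    (I : (n : ℕ) → Fin n → Ω' → Fin n) (α : ℝ) (n : ℕ) (ω : Ω) : ℝ :=
  quantile (bootCdf P' X I n ω) (1 - α)

end BootstrapMeanTest

end

namespace BootstrapMeanTest

open scoped RealInnerProductSpace

/-! Let `S` be the second moment matrix of `X 0` and `ν` the centred Gaussian measure with
covariance `S`. By the central limit theorem `testStat` converges in law to the squared norm under
`ν`. For fixed data the bootstrap draws are i.i.d. uniform on the centred sample, so the normalized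
bootstrap sum has as characteristic function the `n`-th power of an average of exponentials. The
strong law makes the empirical moments converge for almost every data point, and
`tendsto_mean_exp_pow` then gives the same Gaussian limit: negligibility of single observations
comes for free from the convergence of the averages of `‖X j‖ ^ 2`.

Since `S ≠ 0`, spheres are `ν`-null (`multivariateGaussian_setOf_norm_sq_eq`), so the limiting
distribution function `G` is continuous. Hence both distribution functions converge at every point,
and `G` attains every level in `(0, 1)`. Points `c` with `G c` slightly above or below `1 - α` trap
the critical value (`tendsto_measureReal_quantile_lt`); neither convergence of the quantiles nor
strict monotonicity of `G` is needed. -/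

/-! ### Characteristic functions for resampling from deterministic points -/

/-- Second-order Taylor bound for the exponential on the imaginary axis. -/
lemma norm_exp_mul_I_taylor_two_le (u : ℝ) :
    ‖Complex.exp (u * Complex.I) - 1 - u * Complex.I + (u : ℂ) ^ 2 / 2‖
      ≤ |u| ^ 3 * Real.exp |u| := by
  have h := Complex.norm_exp_sub_sum_le_norm_mul_exp ((u : ℂ) * Complex.I) 3
  have e : Complex.exp (u * Complex.I) - 1 - u * Complex.I + (u : ℂ) ^ 2 / 2 =
      Complex.exp (u * Complex.I) -
        ∑ m ∈ Finset.range 3, ((u : ℂ) * Complex.I) ^ m / m.factorial := by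
    simp [Finset.sum_range_succ, mul_pow, Nat.factorial]
    ring
  rw [e]
  simpa using h

/-- Characteristic function form of the central limit theorem for centred triangular arrays of
equally likely, uniformly asymptotically negligible values. -/
lemma tendsto_mean_exp_pow {y : (n : ℕ) → Fin n → ℝ} {v : ℝ}
    (hsum : ∀ n, ∑ j, y n j = 0)
    (hsq : Tendsto (fun n : ℕ ↦ (n : ℝ)⁻¹ * ∑ j, y n j ^ 2) atTop (𝓝 v))
    (hneg : ∀ ε > 0, ∀ᶠ n : ℕ in atTop, ∀ j, |y n j| ≤ ε * √n) :
    Tendsto (fun n : ℕ ↦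
      ((n : ℂ)⁻¹ * ∑ j, Complex.exp (((√n)⁻¹ * y n j : ℝ) * Complex.I)) ^ n) atTop
      (𝓝 (Complex.exp (-(v / 2 : ℝ)))) := by
  set R : ℕ → ℂ := fun n ↦ ∑ j, (Complex.exp (((√n)⁻¹ * y n j : ℝ) * Complex.I) - 1 -
    ((√n)⁻¹ * y n j : ℝ) * Complex.I + (((√n)⁻¹ * y n j : ℝ) : ℂ) ^ 2 / 2) with hR
  have hR0 : Tendsto R atTop (𝓝 0) := by
    rw [Metric.tendsto_atTop']
    intro δ hδ
    have hv : 0 ≤ v := ge_of_tendsto' hsq fun n ↦ by positivity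
    have hlim : Tendsto (fun ε : ℝ ↦ ε * Real.exp ε * (v + 1)) (𝓝[>] 0) (𝓝 0) := by
      have : Continuous fun ε : ℝ ↦ ε * Real.exp ε * (v + 1) := by fun_prop
      simpa using (this.tendsto 0).mono_left nhdsWithin_le_nhds
    -- The cubic remainder gives up one factor `|u| ≤ ε`; the remaining squares sum to at most `v +
    -- 1`.
    obtain ⟨ε, hεδ, hε⟩ := ((hlim.eventually (gt_mem_nhds hδ)).and self_mem_nhdsWithin).exists
    have hε : 0 < ε := hε
    obtain ⟨N, hN⟩ := eventually_atTop.1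
      ((hneg ε hε).and (hsq.eventually (gt_mem_nhds (lt_add_one v))))
    refine ⟨N + 1, fun n hn ↦ ?_⟩
    obtain ⟨h1, h2⟩ := hN n (by omega)
    have hn0 : 0 < (n : ℝ) := by exact_mod_cast (by omega : 0 < n)
    have hs : 0 < √(n : ℝ) := Real.sqrt_pos.2 hn0
    have hu (j : Fin n) : |(√n)⁻¹ * y n j| ≤ ε := by
      rw [abs_mul, abs_of_pos (inv_pos.2 hs), inv_mul_le_iff₀ hs, mul_comm]
      exact h1 j
    rw [dist_zero_right]
    calc ‖R n‖ ≤ ∑ j, |(√n)⁻¹ * y n j| ^ 3 * Real.exp |(√n)⁻¹ * y n j| :=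
          norm_sum_le_of_le _ fun j _ ↦ norm_exp_mul_I_taylor_two_le _
      _ ≤ ∑ j, ε * Real.exp ε * ((n : ℝ)⁻¹ * y n j ^ 2) := by
          refine Finset.sum_le_sum fun j _ ↦ ?_
          have e : (n : ℝ)⁻¹ * y n j ^ 2 = |(√n)⁻¹ * y n j| ^ 2 := by
            rw [sq_abs, mul_pow, inv_pow, Real.sq_sqrt hn0.le]
          rw [e, pow_succ', mul_right_comm]
          gcongr <;> exact hu j
      _ = ε * Real.exp ε * ((n : ℝ)⁻¹ * ∑ j, y n j ^ 2) := by
          simp only [Finset.mul_sum]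
      _ ≤ ε * Real.exp ε * (v + 1) := by gcongr
      _ < δ := hεδ
  -- It remains to see that `n` times (average minus one) tends to `-v / 2`. The linear Taylor terms
  -- cancel by `hsum`, leaving `R n` minus half the mean square.
  have key := Complex.tendsto_one_add_pow_exp_of_tendsto (t := (-(v / 2 : ℝ) : ℂ))
    (g := fun n : ℕ ↦ (n : ℂ)⁻¹ * ∑ j, Complex.exp (((√n)⁻¹ * y n j : ℝ) * Complex.I) - 1) ?_
  · simpa using key
  have hsqC : Tendsto (fun n : ℕ ↦ (((n : ℝ)⁻¹ * ∑ j, y n j ^ 2 : ℝ) : ℂ) / 2) atTop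
      (𝓝 ((v / 2 : ℝ) : ℂ)) := by
    have := ((Complex.continuous_ofReal.tendsto v).comp hsq).div_const 2
    simpa using this
  refine (by simpa using hR0.sub hsqC : Tendsto _ _ (𝓝 (-((v / 2 : ℝ) : ℂ)))).congr' ?_
  filter_upwards [eventually_gt_atTop 0] with n hn
  have hn0 : (n : ℂ) ≠ 0 := by exact_mod_cast hn.ne'
  have e1 : ∑ j, (((√n)⁻¹ * y n j : ℝ) * Complex.I) = 0 := by
    rw [← Finset.sum_mul, ← Complex.ofReal_sum, ← Finset.mul_sum, hsum]
    simp
  have e2 : ∑ j, (((√n)⁻¹ * y n j : ℝ) : ℂ) ^ 2 / 2 =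
      (((n : ℝ)⁻¹ * ∑ j, y n j ^ 2 : ℝ) : ℂ) / 2 := by
    rw [← Finset.sum_div, Finset.mul_sum, Complex.ofReal_sum]
    congr 1
    refine Finset.sum_congr rfl fun j _ ↦ ?_
    rw [← Complex.ofReal_pow, mul_pow, inv_pow, Real.sq_sqrt n.cast_nonneg]
  simp only [hR, Finset.sum_add_distrib, Finset.sum_sub_distrib, e1, e2, mul_sub, ← mul_assoc,
    mul_inv_cancel₀ hn0]
  simp

/-- If averages converge, then no single term contributes asymptotically. -/
lemma eventually_forall_lt_le_mul_of_tendsto_mean {b : ℕ → ℝ} {L : ℝ}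
    (h : Tendsto (fun n : ℕ ↦ (n : ℝ)⁻¹ * ∑ j ∈ Finset.range n, b j) atTop (𝓝 L))
    {ε : ℝ} (hε : 0 < ε) : ∀ᶠ n : ℕ in atTop, ∀ j < n, b j ≤ ε * n := by
  have h1 : Tendsto (fun n : ℕ ↦ (n : ℝ)⁻¹ * b n) atTop (𝓝 0) := by
    have hr : Tendsto (fun n : ℕ ↦ 1 + (n : ℝ)⁻¹) atTop (𝓝 1) := by
      simpa using tendsto_inv_atTop_nhds_zero_nat (𝕜 := ℝ) |>.const_add 1
    -- With `A n` the average, `A (n + 1) * (1 + 1 / n) - A n = b n / n`.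
    have := (((tendsto_add_atTop_iff_nat 1).2 h).mul hr).sub h
    rw [mul_one, sub_self] at this
    refine this.congr' ?_
    filter_upwards [eventually_gt_atTop 0] with n hn
    have hn0 : (n : ℝ) ≠ 0 := by exact_mod_cast hn.ne'
    rw [Finset.sum_range_succ]
    push_cast
    field_simp
    ring
  obtain ⟨N, hN⟩ := eventually_atTop.1 (h1.eventually (gt_mem_nhds hε))
  have h2 : ∀ᶠ n : ℕ in atTop, ∀ j ∈ Finset.range (N + 1), b j ≤ ε * n := by
    rw [Filter.eventually_all_finset]
    intro j _
    exact (tendsto_natCast_atTop_atTop.const_mul_atTop hε).eventually_ge_atTop (b j)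
  filter_upwards [h2] with n hn j hj
  by_cases hjN : j < N + 1
  · exact hn j (Finset.mem_range.2 hjN)
  · have hj0 : 0 < (j : ℝ) := by exact_mod_cast (by omega : 0 < j)
    have := hN j (by omega)
    rw [inv_mul_lt_iff₀ hj0] at this
    have hjn : (j : ℝ) ≤ n := by exact_mod_cast hj.le
    nlinarith

section

variable {E : Type*} [NormedAddCommGroup E] [InnerProductSpace ℝ E]

/-- Characteristic function form of the bootstrap central limit theorem for a deterministic
sequence of observations. -/
lemma tendsto_mean_exp_inner_pow {x : ℕ → E} {t : E} {q L : ℝ}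
    (hmean : Tendsto (fun n : ℕ ↦ (n : ℝ)⁻¹ • ∑ j : Fin n, x j) atTop (𝓝 0))
    (hnorm : Tendsto (fun n : ℕ ↦ (n : ℝ)⁻¹ * ∑ j ∈ Finset.range n, ‖x j‖ ^ 2) atTop (𝓝 L))
    (hsq : Tendsto (fun n : ℕ ↦ (n : ℝ)⁻¹ * ∑ j : Fin n, ⟪x j, t⟫ ^ 2) atTop (𝓝 q)) :
    Tendsto (fun n : ℕ ↦ ((n : ℂ)⁻¹ * ∑ j : Fin n, Complex.exp
      (((√n)⁻¹ * ⟪x j - (n : ℝ)⁻¹ • ∑ k : Fin n, x k, t⟫ : ℝ) * Complex.I)) ^ n) atTop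
      (𝓝 (Complex.exp (-(q / 2 : ℝ)))) := by
  set m : ℕ → E := fun n ↦ (n : ℝ)⁻¹ • ∑ j : Fin n, x j with hm
  have hmsum (n : ℕ) : ∑ j : Fin n, x j = (n : ℝ) • m n := by
    rcases Nat.eq_zero_or_pos n with rfl | hn
    · simp
    · rw [hm, smul_smul, mul_inv_cancel₀ (by exact_mod_cast hn.ne'), one_smul]
  have hmt : Tendsto (fun n ↦ ⟪m n, t⟫) atTop (𝓝 0) := by
    simpa using hmean.inner (tendsto_const_nhds (x := t))
  refine tendsto_mean_exp_pow (y := fun n j ↦ ⟪x j - m n, t⟫) (fun n ↦ ?_) ?_ fun ε hε ↦ ?_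
  · rw [← sum_inner, Finset.sum_sub_distrib, hmsum]
    simp [Nat.cast_smul_eq_nsmul]
  -- Centring lowers the mean square by exactly `⟪m n, t⟫ ^ 2`.
  · have := hsq.sub (hmt.pow 2)
    rw [zero_pow two_ne_zero, sub_zero] at this
    refine this.congr' ?_
    filter_upwards [eventually_gt_atTop 0] with n hn
    have hn0 : (n : ℝ) ≠ 0 := by exact_mod_cast hn.ne'
    have e : ∑ j : Fin n, ⟪x j, t⟫ = n * ⟪m n, t⟫ := by
      rw [← sum_inner, hmsum, real_inner_smul_left]
    simp only [inner_sub_left, sub_sq, Finset.sum_add_distrib, Finset.sum_sub_distrib,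
      ← Finset.sum_mul, ← Finset.mul_sum, e]
    simp
    field_simp
    ring
  -- Both `‖x j‖` and `‖m n‖` will be at most `c * √n`, hence the 2; the `+ 1` covers `t = 0`.
  · set c : ℝ := ε / (2 * (‖t‖ + 1)) with hc
    have hc0 : 0 < c := by positivity
    have hroot : Tendsto (fun n : ℕ ↦ c * √(n : ℝ)) atTop atTop :=
      (Real.tendsto_sqrt_atTop.comp tendsto_natCast_atTop_atTop).const_mul_atTop hc0
    filter_upwards [eventually_forall_lt_le_mul_of_tendsto_mean hnorm
      (pow_pos hc0 2), hroot.eventually_ge_atTop 1,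
      hmean.norm.eventually (gt_mem_nhds (by simp : ‖(0 : E)‖ < 1))] with n h1 h2 h3 j
    have hxj : ‖x j‖ ≤ c * √n := by
      refine abs_le_of_sq_le_sq' ?_ (by positivity) |>.2
      rw [mul_pow, Real.sq_sqrt n.cast_nonneg]
      exact h1 j j.2
    calc |⟪x j - m n, t⟫| ≤ ‖x j - m n‖ * ‖t‖ := abs_real_inner_le_norm _ _
      _ ≤ (‖x j‖ + ‖m n‖) * (‖t‖ + 1) := by
        gcongr
        · exact norm_sub_le _ _
        · linarith
      _ ≤ (c * √n + c * √n) * (‖t‖ + 1) := by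
        gcongr
        exact h3.le.trans h2
      _ = ε * √n := by
        rw [hc]
        field_simp
        ring

end

/-! ### Gaussian measures do not charge spheres -/

section

variable {E : Type*} [NormedAddCommGroup E] [InnerProductSpace ℝ E] [FiniteDimensional ℝ E]
  [MeasurableSpace E] [BorelSpace E]

/-- The standard Gaussian measure splits off an independent one-dimensional standard Gaussian
component in the direction of any unit vector. -/
lemma stdGaussian_eq_conv (b : E) (hb : ‖b‖ = 1) :
    stdGaussian E = ((stdGaussian E).map (fun z ↦ z - ⟪b, z⟫ • b)) ∗
      ((gaussianReal 0 1).map (fun s ↦ s • b)) := by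
  have : IsProbabilityMeasure ((stdGaussian E).map (fun z ↦ z - ⟪b, z⟫ • b)) :=
    Measure.isProbabilityMeasure_map (by fun_prop)
  have : IsProbabilityMeasure ((gaussianReal 0 1).map (fun s : ℝ ↦ s • b)) :=
    Measure.isProbabilityMeasure_map (by fun_prop)
  refine Measure.ext_of_charFun ?_
  ext t
  have h1 : charFun ((stdGaussian E).map (fun z ↦ z - ⟪b, z⟫ • b)) t =
      charFun (stdGaussian E) (t - ⟪b, t⟫ • b) := by
    rw [charFun_apply, charFun_apply, integral_map (by fun_prop)
      (Measurable.aestronglyMeasurable (by fun_prop))]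
    congr with z
    simp only [inner_sub_left, inner_sub_right, real_inner_smul_left, real_inner_smul_right,
      real_inner_comm b z]
    ring_nf
  have h2 : charFun ((gaussianReal 0 1).map (fun s : ℝ ↦ s • b)) t =
      charFun (gaussianReal 0 1) ⟪b, t⟫ := by
    rw [charFun_apply, charFun_apply, integral_map (by fun_prop)
      (Measurable.aestronglyMeasurable (by fun_prop))]
    congr with z
    simp [real_inner_smul_left, mul_comm]
  -- Pythagoras: the two Gaussian exponents add up to `-‖t‖ ^ 2 / 2`.
  have h3 : ‖t - ⟪b, t⟫ • b‖ ^ 2 = ‖t‖ ^ 2 - ⟪b, t⟫ ^ 2 := by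
    rw [norm_sub_sq_real, norm_smul, hb, real_inner_smul_right, real_inner_comm]
    simp
    ring
  rw [charFun_conv, h1, h2, charFun_stdGaussian, charFun_stdGaussian, charFun_gaussianReal,
    ← Complex.exp_add]
  congr 1
  have h3' := congrArg (fun r : ℝ ↦ (r : ℂ)) h3
  push_cast at h3' ⊢
  rw [h3']
  ring

omit [FiniteDimensional ℝ E] [MeasurableSpace E] [BorelSpace E] in
/-- A line that is not constant meets a sphere in finitely many points. -/
lemma finite_setOf_norm_add_smul_sq_eq (w v : E) (hv : v ≠ 0) (r : ℝ) :
    {s : ℝ | ‖w + s • v‖ ^ 2 = r}.Finite := by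
  have hv2 : ‖v‖ ^ 2 ≠ 0 := by simpa using hv
  set p : Polynomial ℝ := .C (‖v‖ ^ 2) * .X ^ 2 + .C (2 * ⟪w, v⟫) * .X + .C (‖w‖ ^ 2 - r)
  have hp : p ≠ 0 := fun h ↦ by
    have := Polynomial.natDegree_quadratic (a := ‖v‖ ^ 2) (b := 2 * ⟪w, v⟫) (c := ‖w‖ ^ 2 - r) hv2
    change p.natDegree = 2 at this
    simp [h] at this
  refine (Polynomial.finite_setOfPred_isRoot hp).subset fun s hs ↦ ?_
  have hs : ‖w + s • v‖ ^ 2 = r := hs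
  rw [norm_add_sq_real, norm_smul, real_inner_smul_right, mul_pow, Real.norm_eq_abs, sq_abs] at hs
  simp only [Set.mem_ofPred_eq, Polynomial.IsRoot.def, p]
  simp
  linarith

/-- A nonzero linear image of the standard Gaussian measure gives no mass to spheres. -/
lemma stdGaussian_setOf_norm_apply_sq_eq {F : Type*} [NormedAddCommGroup F]
    [InnerProductSpace ℝ F] (A : E →L[ℝ] F) (hA : A ≠ 0) (r : ℝ) :
    stdGaussian E {z | ‖A z‖ ^ 2 = r} = 0 := by
  obtain ⟨b, hb, hAb⟩ : ∃ b : E, ‖b‖ = 1 ∧ A b ≠ 0 := by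
    obtain ⟨u, hu⟩ : ∃ u, A u ≠ 0 := by
      by_contra! h
      exact hA (ContinuousLinearMap.ext h)
    have hu0 : u ≠ 0 := fun h ↦ hu (by simp [h])
    refine ⟨(‖u‖)⁻¹ • u, ?_, ?_⟩
    · rw [norm_smul, norm_inv, norm_norm, inv_mul_cancel₀ (norm_ne_zero_iff.2 hu0)]
    · simpa [hu0] using hu
  have : IsProbabilityMeasure ((stdGaussian E).map (fun z ↦ z - ⟪b, z⟫ • b)) :=
    Measure.isProbabilityMeasure_map (by fun_prop)
  have : IsProbabilityMeasure ((gaussianReal 0 1).map (fun s : ℝ ↦ s • b)) :=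
    Measure.isProbabilityMeasure_map (by fun_prop)
  have : NullSingletonClass (gaussianReal 0 1) := nullSingletonClass_gaussianReal one_ne_zero
  have hmeas : MeasurableSet {z | ‖A z‖ ^ 2 = r} :=
    (isClosed_eq (by fun_prop) continuous_const).measurableSet
  rw [stdGaussian_eq_conv b hb, Measure.conv, Measure.map_apply (by fun_prop) hmeas,
    Measure.measure_prod_null (hmeas.preimage (by fun_prop))]
  -- For a fixed first component `w`, the condition on the coefficient of `b` is a genuine quadratic
  -- equation because `A b ≠ 0`, so it holds on a finite, hence null, set.
  refine Eventually.of_forall fun w ↦ ?_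
  dsimp only
  rw [Measure.map_apply (by fun_prop)]
  · refine Set.Finite.measure_zero ?_ _
    simpa [Set.preimage, add_comm] using finite_setOf_norm_add_smul_sq_eq (A w) (A b) hAb r
  · exact measurable_prodMk_left (hmeas.preimage (by fun_prop))

end

open scoped MatrixOrder in
/-- A Gaussian measure with nonzero covariance matrix gives no mass to spheres. -/
lemma multivariateGaussian_setOf_norm_sq_eq {ι : Type*} [Fintype ι] [DecidableEq ι]
    {S : Matrix ι ι ℝ} (hS : S.PosSemidef) (hS0 : S ≠ 0) (r : ℝ) :
    multivariateGaussian 0 S {z | ‖z‖ ^ 2 = r} = 0 := by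
  have hmeas : MeasurableSet {z : EuclideanSpace ℝ ι | ‖z‖ ^ 2 = r} :=
    (isClosed_eq (by fun_prop) continuous_const).measurableSet
  rw [multivariateGaussian, Measure.map_apply (by fun_prop) hmeas]
  simp only [zero_add]
  refine stdGaussian_setOf_norm_apply_sq_eq _ (fun h ↦ hS0 ?_) r
  have h0 : CFC.sqrt S = 0 := by simpa using h
  rw [← CFC.sqrt_mul_sqrt_self S hS.nonneg, h0, zero_mul]

/-! ### From characteristic functions to distribution functions of the squared norm -/

section

variable {E : Type*} [NormedAddCommGroup E] [InnerProductSpace ℝ E]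

lemma natCast_mul_norm_inv_smul_sq (n : ℕ) (s : E) :
    (n : ℝ) * ‖(n : ℝ)⁻¹ • s‖ ^ 2 = ‖(√n)⁻¹ • s‖ ^ 2 := by
  rw [norm_smul, norm_smul, mul_pow, mul_pow, norm_inv, norm_inv, inv_pow, inv_pow,
    Real.norm_of_nonneg n.cast_nonneg, Real.norm_of_nonneg (Real.sqrt_nonneg _),
    Real.sq_sqrt n.cast_nonneg, ← mul_assoc]
  rcases Nat.eq_zero_or_pos n with rfl | hn
  · simp
  · have : (n : ℝ) ≠ 0 := by exact_mod_cast hn.ne'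
    field_simp

variable [MeasurableSpace E] [BorelSpace E]

/-- The characteristic function of a normalized sum of `n` independent draws with replacement from
the points `x 0, …, x (n - 1)`. -/
lemma charFun_map_inv_sqrt_smul_sum_resample [FiniteDimensional ℝ E]
    {Ω' : Type*} [MeasurableSpace Ω'] {P' : Measure Ω'} [IsProbabilityMeasure P'] {n : ℕ}
    {J : Fin n → Ω' → Fin n} (hJ : ∀ k, Measurable (J k)) (hindep : iIndepFun J P')
    (hunif : ∀ k j, P'.real {ω' | J k ω' = j} = 1 / (n : ℝ)) (x : Fin n → E) (t : E) :
    charFun (P'.map (fun ω' ↦ (√(n : ℝ))⁻¹ • ∑ k, x (J k ω'))) t =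
      ((n : ℂ)⁻¹ * ∑ j, Complex.exp (((√n)⁻¹ * ⟪x j, t⟫ : ℝ) * Complex.I)) ^ n := by
  have hfactor (k : Fin n) : charFun (P'.map (fun ω' ↦ (√(n : ℝ))⁻¹ • x (J k ω'))) t =
      (n : ℂ)⁻¹ * ∑ j, Complex.exp (((√n)⁻¹ * ⟪x j, t⟫ : ℝ) * Complex.I) := by
    have hg : Measurable fun j ↦ (√(n : ℝ))⁻¹ • x j := measurable_of_countable _
    have : IsProbabilityMeasure (P'.map (J k)) :=
      Measure.isProbabilityMeasure_map (hJ k).aemeasurable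
    rw [← Function.comp_def (fun j ↦ (√(n : ℝ))⁻¹ • x j), ← Measure.map_map hg (hJ k),
      charFun_apply, integral_map hg.aemeasurable (Measurable.aestronglyMeasurable (by fun_prop)),
      integral_fintype .of_finite, Finset.mul_sum]
    refine Finset.sum_congr rfl fun j _ ↦ ?_
    have hj : (P'.map (J k)).real {j} = 1 / (n : ℝ) := by
      rw [map_measureReal_apply (hJ k) (measurableSet_singleton j), ← hunif k j]
      rfl
    rw [hj, real_inner_smul_left, Complex.real_smul]
    simp
  simp only [Finset.smul_sum]
  rw [iIndepFun.charFun_map_fun_sum_eq_prod (X := fun k ω' ↦ (√(n : ℝ))⁻¹ • x (J k ω'))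
    (fun k ↦ ((measurable_of_countable fun j ↦ (√(n : ℝ))⁻¹ • x j).comp (hJ k)).aemeasurable)
    (hindep.comp (fun _ j ↦ (√(n : ℝ))⁻¹ • x j) fun _ ↦ measurable_of_countable _)]
  simp [Finset.prod_apply, hfactor]

/-- Convergence of characteristic functions implies convergence of the distribution functions of
the squared norm, provided the limit gives no mass to spheres. -/
lemma tendsto_measureReal_norm_sq_le [FiniteDimensional ℝ E] {μ : ℕ → Measure E}
    [∀ n, IsProbabilityMeasure (μ n)] {ν : Measure E} [IsProbabilityMeasure ν]
    (h : ∀ t, Tendsto (fun n ↦ charFun (μ n) t) atTop (𝓝 (charFun ν t)))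
    (hν : ∀ r : ℝ, ν {z | ‖z‖ ^ 2 = r} = 0) (c : ℝ) :
    Tendsto (fun n ↦ (μ n).real {z | ‖z‖ ^ 2 ≤ c}) atTop (𝓝 (ν.real {z | ‖z‖ ^ 2 ≤ c})) := by
  have key := ProbabilityMeasure.tendsto_of_tendsto_charFun (μ := fun n ↦ ⟨μ n, inferInstance⟩)
    (μ₀ := ⟨ν, inferInstance⟩) h
  have hfr : ν (frontier {z | ‖z‖ ^ 2 ≤ c}) = 0 :=
    measure_mono_null (frontier_le_subset_eq (by fun_prop) continuous_const) (hν c)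
  exact (ENNReal.tendsto_toReal (measure_ne_top _ _)).comp
    (ProbabilityMeasure.tendsto_measure_of_null_frontier_of_tendsto' key hfr)

omit [InnerProductSpace ℝ E] in
/-- The distribution function of the squared norm under a measure without mass on spheres takes
every value strictly between zero and one. -/
lemma exists_measureReal_norm_sq_le_eq {ν : Measure E} [IsProbabilityMeasure ν]
    (hν : ∀ r : ℝ, ν {z | ‖z‖ ^ 2 = r} = 0) {p : ℝ} (hp : p ∈ Set.Ioo (0 : ℝ) 1) :
    ∃ c : ℝ, ν.real {z | ‖z‖ ^ 2 ≤ c} = p := by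
  have hm : Measurable fun z : E ↦ ‖z‖ ^ 2 := by fun_prop
  set ρ := ν.map fun z ↦ ‖z‖ ^ 2
  have : IsProbabilityMeasure ρ := Measure.isProbabilityMeasure_map hm.aemeasurable
  have hcdf (c : ℝ) : cdf ρ c = ν.real {z | ‖z‖ ^ 2 ≤ c} := by
    rw [cdf_eq_real, map_measureReal_apply hm measurableSet_Iic]
    rfl
  have hcont : Continuous (cdf ρ) := by
    rw [continuous_iff_continuousAt]
    intro r
    -- The jump of the distribution function at `r` is the mass of a sphere.
    rw [(cdf ρ).mono.continuousAt_iff_leftLim_eq_rightLim, StieltjesFunction.rightLim_eq]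
    have h0 : (cdf ρ).measure {r} = 0 := by
      rw [measure_cdf, Measure.map_apply hm (measurableSet_singleton r)]
      exact hν r
    rw [StieltjesFunction.measure_singleton, ENNReal.ofReal_eq_zero] at h0
    exact le_antisymm ((cdf ρ).mono.leftLim_le le_rfl) (by linarith)
  obtain ⟨c, hc⟩ := mem_range_of_exists_le_of_exists_ge hcont
    (((tendsto_cdf_atBot ρ).eventually (gt_mem_nhds hp.1)).exists.imp fun _ h ↦ h.le)
    (((tendsto_cdf_atTop ρ).eventually (lt_mem_nhds hp.2)).exists.imp fun _ h ↦ h.le)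
  exact ⟨c, by rw [← hcdf, hc]⟩

end

/-! ### Limit laws of the bootstrap statistic and the test statistic -/

section

variable {E : Type*} [NormedAddCommGroup E] [InnerProductSpace ℝ E] [FiniteDimensional ℝ E]
  [MeasurableSpace E] [BorelSpace E] {Ω Ω' : Type*} [MeasurableSpace Ω']

/-- Consistency of the bootstrap distribution function at a data point whose empirical first and
second moments converge. -/
lemma tendsto_bootCdf {P' : Measure Ω'} [IsProbabilityMeasure P'] {X : ℕ → Ω → E}
    {I : (n : ℕ) → Fin n → Ω' → Fin n} (hI_meas : ∀ n k, Measurable (I n k))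
    (hI_indep : ∀ n, iIndepFun (I n) P')
    (hI_unif : ∀ n (k j : Fin n), P'.real {ω' | I n k ω' = j} = 1 / (n : ℝ))
    {ν : Measure E} [IsProbabilityMeasure ν] (hν : ∀ r : ℝ, ν {z | ‖z‖ ^ 2 = r} = 0)
    {q : E → ℝ} (hνq : ∀ t, charFun ν t = Complex.exp (-(q t / 2 : ℝ))) {L : ℝ} {ω : Ω}
    (hmean : Tendsto (fun n ↦ sampleMean X n ω) atTop (𝓝 0))
    (hnorm : Tendsto (fun n : ℕ ↦ (n : ℝ)⁻¹ * ∑ j ∈ Finset.range n, ‖X j ω‖ ^ 2) atTop (𝓝 L))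
    (hsq : ∀ t, Tendsto (fun n : ℕ ↦ (n : ℝ)⁻¹ * ∑ j : Fin n, ⟪X j ω, t⟫ ^ 2) atTop (𝓝 (q t)))
    (c : ℝ) :
    Tendsto (fun n ↦ bootCdf P' X I n ω c) atTop (𝓝 (ν.real {z | ‖z‖ ^ 2 ≤ c})) := by
  set Z : ℕ → Ω' → E := fun n ω' ↦
    (√(n : ℝ))⁻¹ • ∑ k : Fin n, (X (I n k ω') ω - sampleMean X n ω) with hZ
  have hZm (n : ℕ) : Measurable (Z n) :=
    (Finset.measurable_sum _ fun k _ ↦ (measurable_of_countable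
      fun j : Fin n ↦ X j ω - sampleMean X n ω).comp (hI_meas n k)).const_smul _
  have (n : ℕ) : IsProbabilityMeasure (P'.map (Z n)) :=
    Measure.isProbabilityMeasure_map (hZm n).aemeasurable
  have hcdf (n : ℕ) : bootCdf P' X I n ω c = (P'.map (Z n)).real {z | ‖z‖ ^ 2 ≤ c} := by
    rw [map_measureReal_apply (hZm n) (measurableSet_le (by fun_prop) measurable_const)]
    simp only [bootCdf, bootStat, bootObs, natCast_mul_norm_inv_smul_sq, hZ, Set.preimage,
      Set.mem_ofPred_eq]
  simp only [hcdf]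
  refine tendsto_measureReal_norm_sq_le (fun t ↦ ?_) hν c
  rw [hνq]
  refine (tendsto_mean_exp_inner_pow (x := fun j ↦ X j ω) hmean hnorm (hsq t)).congr fun n ↦ ?_
  exact (charFun_map_inv_sqrt_smul_sum_resample (hI_meas n) (hI_indep n) (hI_unif n)
    (fun j ↦ X j ω - sampleMean X n ω) t).symm

/-- The central limit theorem for the test statistic. -/
lemma tendsto_measureReal_testStat_le [MeasurableSpace Ω] {P : Measure Ω} [IsProbabilityMeasure P]
    {X : ℕ → Ω → E} (hX_meas : ∀ i, Measurable (X i)) (hX_indep : iIndepFun X P)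
    (hX_ident : ∀ i, IdentDistrib (X i) (X 0) P P)
    (hX_sq : Integrable (fun ω ↦ ‖X 0 ω‖ ^ 2) P) (hX_mean : ∫ ω, X 0 ω ∂P = 0)
    {ν : Measure E} [IsProbabilityMeasure ν] (hν : ∀ r : ℝ, ν {z | ‖z‖ ^ 2 = r} = 0)
    (hνq : ∀ t, charFun ν t = Complex.exp (-((∫ ω, ⟪X 0 ω, t⟫ ^ 2 ∂P) / 2 : ℝ))) (c : ℝ) :
    Tendsto (fun n ↦ P.real {ω | testStat X n ω ≤ c}) atTop (𝓝 (ν.real {z | ‖z‖ ^ 2 ≤ c})) := by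
  set Z : ℕ → Ω → E := fun n ω ↦ (√(n : ℝ))⁻¹ • ∑ k ∈ Finset.range n, X k ω with hZ
  have hZm (n : ℕ) : Measurable (Z n) := by fun_prop
  have (n : ℕ) : IsProbabilityMeasure (P.map (Z n)) :=
    Measure.isProbabilityMeasure_map (hZm n).aemeasurable
  have hcdf (n : ℕ) : P.real {ω | testStat X n ω ≤ c} = (P.map (Z n)).real {z | ‖z‖ ^ 2 ≤ c} := by
    rw [map_measureReal_apply (hZm n) (measurableSet_le (by fun_prop) measurable_const)]
    simp only [testStat, sampleMean, natCast_mul_norm_inv_smul_sq, hZ, Set.preimage,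
      Set.mem_ofPred_eq, ← Fin.sum_univ_eq_sum_range (fun k ↦ X k _)]
  simp only [hcdf]
  refine tendsto_measureReal_norm_sq_le (fun t ↦ ?_) hν c
  have hL2 : MemLp (X 0) 2 P :=
    (memLp_two_iff_integrable_sq_norm (hX_meas 0).aestronglyMeasurable).2 hX_sq
  have hmt : Measurable fun x : E ↦ ⟪x, t⟫ := by fun_prop
  have hL2t : MemLp (fun ω ↦ ⟪X 0 ω, t⟫) 2 P := hL2.inner_const t
  have hmeant : ∫ ω, ⟪X 0 ω, t⟫ ∂P = 0 := by
    simp_rw [real_inner_comm]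
    rw [integral_inner (hL2.integrable one_le_two), hX_mean, inner_zero_right]
  have hvar : Var[fun ω ↦ ⟪X 0 ω, t⟫; P] = ∫ ω, ⟪X 0 ω, t⟫ ^ 2 ∂P := by
    rw [variance_of_integral_eq_zero hL2t.aestronglyMeasurable.aemeasurable hmeant]
  have hclt := (tendstoInDistribution_inv_sqrt_mul_sum_sub (P := P)
    (X := fun n ω ↦ ⟪X n ω, t⟫) HasLaw.id hL2t (hX_indep.comp (fun _ x ↦ ⟪x, t⟫) fun _ ↦ hmt)
    fun i ↦ (hX_ident i).comp hmt).tendsto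
  -- Cramér–Wold: the characteristic function of `Z n` at `t` is that of its projection on `t` at 1.
  have h1 := ProbabilityMeasure.tendsto_iff_tendsto_charFun.1 hclt 1
  rw [hνq]
  convert h1 using 2 with n
  · have e : (fun ω ↦ (√(n : ℝ))⁻¹ * (∑ k ∈ Finset.range n, ⟪X k ω, t⟫ - n * P[fun ω ↦ ⟪X 0 ω, t⟫]))
        = (fun x : E ↦ ⟪x, t⟫) ∘ Z n := by
      ext ω
      simp only [hmeant, hZ, Function.comp_apply, real_inner_smul_left, sum_inner]
      ring
    simp only [ProbabilityMeasure.coe_mk, e]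
    rw [← Measure.map_map hmt (hZm n), charFun_apply, charFun_apply, integral_map hmt.aemeasurable
      (Measurable.aestronglyMeasurable (by fun_prop))]
    simp
  · simp only [ProbabilityMeasure.coe_mk, Measure.map_id, charFun_gaussianReal, hvar]
    have hnn : 0 ≤ ∫ ω, ⟪X 0 ω, t⟫ ^ 2 ∂P := integral_nonneg fun ω ↦ sq_nonneg _
    simp [max_eq_left hnn]

end

/-! ### Exceeding a random quantile -/

section

variable {Ω : Type*} [MeasurableSpace Ω] {P : Measure Ω} [IsProbabilityMeasure P]

/-- Measurable sets to which almost every point eventually does not belong have measures tending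
to zero. -/
lemma tendsto_measureReal_of_ae_eventually_notMem {A : ℕ → Set Ω}
    (hA : ∀ n, MeasurableSet (A n)) (h : ∀ᵐ ω ∂P, ∀ᶠ n in atTop, ω ∉ A n) :
    Tendsto (fun n ↦ P.real (A n)) atTop (𝓝 0) := by
  have := tendsto_measure_of_ae_tendsto_indicator_of_isFiniteMeasure (μ := P) atTop
    (A := (∅ : Set Ω)) .empty hA (by simpa using h)
  simpa [Function.comp_def, measureReal_def] using
    (ENNReal.tendsto_toReal (measure_ne_top P ∅)).comp this

/-- If random distribution functions converge pointwise almost surely to the limiting distribution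
function of a sequence of statistics, then the statistics exceed the random `p`-quantiles with
probability tending to `1 - p`. -/
lemma tendsto_measureReal_quantile_lt {V Q : ℕ → Ω → ℝ} {F : ℕ → Ω → ℝ → ℝ} {G : ℝ → ℝ} {p : ℝ}
    (hp : p ∈ Set.Ioo (0 : ℝ) 1) (hV_meas : ∀ n, Measurable (V n))
    (hV : ∀ c, Tendsto (fun n ↦ P.real {ω | V n ω ≤ c}) atTop (𝓝 (G c)))
    (hF_meas : ∀ n c, Measurable fun ω ↦ F n ω c)
    (hF : ∀ᵐ ω ∂P, ∀ c, Tendsto (fun n ↦ F n ω c) atTop (𝓝 (G c)))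
    (hG : ∀ r ∈ Set.Ioo (0 : ℝ) 1, ∃ c, G c = r)
    (hle : ∀ n ω c, p ≤ F n ω c → Q n ω ≤ c) (hge : ∀ n ω c, F n ω c < p → c ≤ Q n ω) :
    Tendsto (fun n ↦ P.real {ω | Q n ω < V n ω}) atTop (𝓝 (1 - p)) := by
  have hgt (c : ℝ) : Tendsto (fun n ↦ P.real {ω | c < V n ω}) atTop (𝓝 (1 - G c)) := by
    refine ((hV c).const_sub 1).congr fun n ↦ ?_
    rw [← probReal_compl_eq_one_sub (measurableSet_le (hV_meas n) measurable_const)]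
    congr 1
    ext ω
    simp
  refine tendsto_order.2 ⟨fun a ha ↦ ?_, fun a ha ↦ ?_⟩
  -- At `c` with `G c = r > p`, almost surely eventually `p ≤ F n ω c`, so `Q n ω ≤ c`, and the
  -- limiting lower bound is `1 - r > a`. The second case is symmetric with `r < p`. Monotonicity of
  -- the measure suffices, so `Q` need not be measurable.
  · obtain ⟨r, hpr, hr⟩ := exists_between (lt_min hp.2 (by linarith : p < 1 - a))
    obtain ⟨hr1, hra⟩ := lt_min_iff.1 hr
    obtain ⟨c, hc⟩ := hG r ⟨hp.1.trans hpr, hr1⟩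
    have hbad : Tendsto (fun n ↦ P.real {ω | F n ω c < p}) atTop (𝓝 0) := by
      refine tendsto_measureReal_of_ae_eventually_notMem
        (fun n ↦ measurableSet_lt (hF_meas n c) measurable_const) ?_
      filter_upwards [hF] with ω hω
      filter_upwards [(hω c).eventually (lt_mem_nhds (hpr.trans_eq hc.symm))] with n hn
      simpa using hn.le
    have hlim := (hgt c).sub hbad
    filter_upwards [hlim.eventually (lt_mem_nhds (by rw [hc]; linarith : a < 1 - G c - 0))]
      with n hn
    have hsub : {ω | c < V n ω} ⊆ {ω | Q n ω < V n ω} ∪ {ω | F n ω c < p} := fun ω hω ↦ by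
      by_cases h : F n ω c < p
      · exact .inr h
      · exact .inl ((hle n ω c (not_lt.1 h)).trans_lt hω)
    have := (measureReal_mono (μ := P) hsub).trans (measureReal_union_le _ _)
    linarith
  · obtain ⟨r, hr, hrp⟩ := exists_between (max_lt hp.1 (by linarith : 1 - a < p))
    obtain ⟨hr0, hra⟩ := max_lt_iff.1 hr
    obtain ⟨c, hc⟩ := hG r ⟨hr0, hrp.trans hp.2⟩
    have hbad : Tendsto (fun n ↦ P.real {ω | p ≤ F n ω c}) atTop (𝓝 0) := by
      refine tendsto_measureReal_of_ae_eventually_notMem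
        (fun n ↦ measurableSet_le measurable_const (hF_meas n c)) ?_
      filter_upwards [hF] with ω hω
      filter_upwards [(hω c).eventually (gt_mem_nhds (hc.trans_lt hrp))] with n hn
      simpa using hn
    have hlim := (hgt c).add hbad
    filter_upwards [hlim.eventually (gt_mem_nhds (by rw [hc]; linarith : 1 - G c + 0 < a))]
      with n hn
    have hsub : {ω | Q n ω < V n ω} ⊆ {ω | c < V n ω} ∪ {ω | p ≤ F n ω c} := fun ω hω ↦ by
      by_cases h : F n ω c < p
      · exact .inl ((hge n ω c h).trans_lt hω)
      · exact .inr (not_lt.1 h)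
    have := (measureReal_mono (μ := P) hsub).trans (measureReal_union_le _ _)
    linarith

end

/-! ### Bootstrap distribution function and critical value -/

section

variable {Ω Ω' E : Type*} [NormedAddCommGroup E] [InnerProductSpace ℝ E] [MeasurableSpace Ω']
  {P' : Measure Ω'} {X : ℕ → Ω → E} {I : (n : ℕ) → Fin n → Ω' → Fin n}

omit [MeasurableSpace Ω'] in
lemma bootStat_nonneg (n : ℕ) (ω : Ω) (ω' : Ω') : 0 ≤ bootStat X I n ω ω' := by
  unfold bootStat
  positivity

/-- The bootstrap distribution function vanishes on negative arguments. -/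
lemma bootCdf_of_neg (n : ℕ) (ω : Ω) {x : ℝ} (hx : x < 0) : bootCdf P' X I n ω x = 0 := by
  have : {ω' | bootStat X I n ω ω' ≤ x} = ∅ :=
    Set.eq_empty_of_forall_notMem fun ω' h ↦
      absurd ((bootStat_nonneg n ω ω').trans h) (not_le.2 hx)
  simp [bootCdf, this]

lemma bootCdf_mono [IsFiniteMeasure P'] (n : ℕ) (ω : Ω) : Monotone (bootCdf P' X I n ω) :=
  fun _ _ h ↦ measureReal_mono fun _ h' ↦ le_trans h' h

/-- The bootstrap distribution function is eventually equal to one. -/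
lemma exists_bootCdf_eq_one [IsProbabilityMeasure P'] (n : ℕ) (ω : Ω) :
    ∃ x, bootCdf P' X I n ω x = 1 := by
  -- For fixed data the statistic depends only on the index map, so it takes finitely many values.
  set f : (Fin n → Fin n) → ℝ := fun σ ↦
    (n : ℝ) * ‖(n : ℝ)⁻¹ • ∑ k : Fin n, (X (σ k) ω - sampleMean X n ω)‖ ^ 2
  obtain ⟨M, hM⟩ := (Set.finite_range f).bddAbove
  refine ⟨M, ?_⟩
  have : {ω' | bootStat X I n ω ω' ≤ M} = Set.univ :=
    Set.eq_univ_of_forall fun ω' ↦ hM ⟨fun k ↦ I n k ω', rfl⟩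
  simp [bootCdf, this]

/-- The infimum is over a set bounded below by 0: the distribution function vanishes on negatives,
while `1 - α > 0`. -/
lemma bootQuantile_le {α : ℝ} (hα : α < 1) {n : ℕ} {ω : Ω} {c : ℝ}
    (h : 1 - α ≤ bootCdf P' X I n ω c) : bootQuantile P' X I α n ω ≤ c := by
  refine csInf_le ⟨0, fun x hx ↦ ?_⟩ h
  by_contra! hx0
  have hx : 1 - α ≤ bootCdf P' X I n ω x := hx
  rw [bootCdf_of_neg n ω hx0] at hx
  linarith

/-- Monotonicity makes `c` a lower bound; the set is nonempty because the distribution function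
reaches 1. -/
lemma le_bootQuantile [IsProbabilityMeasure P'] {α : ℝ} (hα : 0 < α) {n : ℕ} {ω : Ω} {c : ℝ}
    (h : bootCdf P' X I n ω c < 1 - α) : c ≤ bootQuantile P' X I α n ω := by
  obtain ⟨x, hx⟩ := exists_bootCdf_eq_one (P' := P') (X := X) (I := I) n ω
  refine le_csInf ⟨x, ?_⟩ fun y hy ↦ ?_
  · change 1 - α ≤ bootCdf P' X I n ω x
    linarith
  · by_contra! hyc
    have hy : 1 - α ≤ bootCdf P' X I n ω y := hy
    exact absurd (hy.trans (bootCdf_mono n ω hyc.le)) (not_le.2 h)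

variable [MeasurableSpace Ω] [MeasurableSpace E] [BorelSpace E] [SecondCountableTopology E]

lemma measurable_sampleMean (hX : ∀ i, Measurable (X i)) (n : ℕ) : Measurable (sampleMean X n) := by
  unfold sampleMean
  fun_prop

lemma measurable_testStat (hX : ∀ i, Measurable (X i)) (n : ℕ) : Measurable (testStat X n) := by
  have := measurable_sampleMean hX n
  unfold testStat
  fun_prop

/-- The bootstrap distribution function depends measurably on the data. -/
lemma measurable_bootCdf [IsProbabilityMeasure P'] (hX : ∀ i, Measurable (X i))
    (hI : ∀ n k, Measurable (I n k)) (n : ℕ) (c : ℝ) :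
    Measurable fun ω ↦ bootCdf P' X I n ω c := by
  have hobs (k : Fin n) : Measurable fun q : Ω × Ω' ↦ X (I n k q.2) q.1 := by
    -- Joint measurability holds because the index ranges over a countable type.
    have : Measurable fun q : Ω × Fin n ↦ X q.2 q.1 :=
      measurable_from_prod_countable_left fun j ↦ hX j
    exact this.comp (measurable_fst.prodMk ((hI n k).comp measurable_snd))
  have hm : Measurable fun q : Ω × Ω' ↦ sampleMean X n q.1 :=
    (measurable_sampleMean hX n).comp measurable_fst
  have hstat : Measurable fun q : Ω × Ω' ↦ bootStat X I n q.1 q.2 := by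
    exact ((Finset.measurable_sum _ fun k _ ↦ (hobs k).sub hm).const_smul _).norm.pow_const 2
      |>.const_mul _
  exact (measurable_measure_prodMk_left
    (measurableSet_le hstat measurable_const : MeasurableSet
      {q : Ω × Ω' | bootStat X I n q.1 q.2 ≤ c})).ennreal_toReal

end

/-! ### Second moments and strong laws -/

section

variable {ι Ω : Type*} [Fintype ι] [MeasurableSpace Ω] {P : Measure Ω}
  {Y : Ω → EuclideanSpace ℝ ι}

/-- The matrix of second moments of a random vector. -/
noncomputable def secondMoment (P : Measure Ω) (Y : Ω → EuclideanSpace ℝ ι) : Matrix ι ι ℝ :=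
  .of fun a b ↦ ∫ ω, Y ω a * Y ω b ∂P

lemma integrable_coord_mul_coord (hY : MemLp Y 2 P) (a b : ι) :
    Integrable (fun ω ↦ Y ω a * Y ω b) P := by
  have h (c : ι) : MemLp (fun ω ↦ Y ω c) 2 P :=
    (EuclideanSpace.proj (𝕜 := ℝ) c).comp_memLp' hY
  exact (h a).integrable_mul (h b)

/-- Separates `t` from `y`: the strong law for finitely many coordinate products then gives one null
set valid for all directions `t`. -/
lemma inner_sq_eq_sum (y t : EuclideanSpace ℝ ι) :
    ⟪y, t⟫ ^ 2 = ∑ a, ∑ b, t a * t b * (y a * y b) := by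
  rw [PiLp.inner_apply, sq, Finset.sum_mul_sum]
  refine Finset.sum_congr rfl fun a _ ↦ Finset.sum_congr rfl fun b _ ↦ ?_
  simp
  ring

lemma integral_inner_sq_eq_sum (hY : MemLp Y 2 P) (t : EuclideanSpace ℝ ι) :
    ∫ ω, ⟪Y ω, t⟫ ^ 2 ∂P = ∑ a, ∑ b, t a * t b * secondMoment P Y a b := by
  simp_rw [inner_sq_eq_sum]
  rw [integral_finsetSum _ fun a _ ↦ integrable_finsetSum _ fun b _ ↦
    (integrable_coord_mul_coord hY a b).const_mul _]
  refine Finset.sum_congr rfl fun a _ ↦ ?_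
  rw [integral_finsetSum _ fun b _ ↦ (integrable_coord_mul_coord hY a b).const_mul _]
  simp only [integral_const_mul, secondMoment, Matrix.of_apply]

lemma dotProduct_secondMoment_mulVec (hY : MemLp Y 2 P) (t : EuclideanSpace ℝ ι) :
    dotProduct t.ofLp ((secondMoment P Y).mulVec t.ofLp) = ∫ ω, ⟪Y ω, t⟫ ^ 2 ∂P := by
  rw [integral_inner_sq_eq_sum hY]
  simp only [dotProduct, Matrix.mulVec, Finset.mul_sum]
  refine Finset.sum_congr rfl fun a _ ↦ Finset.sum_congr rfl fun b _ ↦ ?_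
  ring

lemma posSemidef_secondMoment (hY : MemLp Y 2 P) : (secondMoment P Y).PosSemidef := by
  refine .of_dotProduct_mulVec_nonneg ?_ fun t ↦ ?_
  · ext a b
    simp [secondMoment, mul_comm]
  · rw [star_trivial, ← WithLp.ofLp_toLp 2 t, dotProduct_secondMoment_mulVec hY]
    exact integral_nonneg fun ω ↦ sq_nonneg _

/-- The diagonal alone suffices: a vanishing second moment forces that coordinate to vanish almost
surely. -/
lemma secondMoment_ne_zero (hY : MemLp Y 2 P) (h : ¬ ∀ᵐ ω ∂P, Y ω = 0) :
    secondMoment P Y ≠ 0 := by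
  intro h0
  apply h
  have hcoord (a : ι) : ∀ᵐ ω ∂P, Y ω a = 0 := by
    have ha : ∫ ω, Y ω a * Y ω a ∂P = 0 := congrFun (congrFun h0 a) a
    rw [integral_eq_zero_iff_of_nonneg (fun ω ↦ mul_self_nonneg _)
      (integrable_coord_mul_coord hY a a)] at ha
    filter_upwards [ha] with ω hω
    simpa using hω
  filter_upwards [ae_all_iff.2 hcoord] with ω hω
  ext a
  simpa using hω a

/-- The characteristic function of the centred Gaussian measure with the same second moments as a
given square integrable random vector. -/
lemma charFun_multivariateGaussian_secondMoment [DecidableEq ι] (hY : MemLp Y 2 P)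
    (t : EuclideanSpace ℝ ι) :
    charFun (multivariateGaussian 0 (secondMoment P Y)) t =
      Complex.exp (-((∫ ω, ⟪Y ω, t⟫ ^ 2 ∂P) / 2 : ℝ)) := by
  rw [charFun_multivariateGaussian (posSemidef_secondMoment hY),
    dotProduct_secondMoment_mulVec hY]
  simp

lemma ae_tendsto_sampleMean {E : Type*} [NormedAddCommGroup E] [NormedSpace ℝ E] [CompleteSpace E]
    [MeasurableSpace E] [BorelSpace E] {X : ℕ → Ω → E}
    (hX_indep : iIndepFun X P)
    (hX_ident : ∀ i, IdentDistrib (X i) (X 0) P P) (hX_int : Integrable (X 0) P) :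
    ∀ᵐ ω ∂P, Tendsto (fun n ↦ sampleMean X n ω) atTop (𝓝 (∫ ω, X 0 ω ∂P)) := by
  filter_upwards [strong_law_ae X hX_int (fun i j hij ↦ hX_indep.indepFun hij) hX_ident] with ω hω
  simpa only [sampleMean, Fin.sum_univ_eq_sum_range (fun k ↦ X k ω)] using hω

/-- Almost surely, the empirical second moments in all directions converge simultaneously. -/
lemma ae_tendsto_mean_inner_sq {X : ℕ → Ω → EuclideanSpace ℝ ι} (hX_indep : iIndepFun X P)
    (hX_ident : ∀ i, IdentDistrib (X i) (X 0) P P) (hX : MemLp (X 0) 2 P) :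
    ∀ᵐ ω ∂P, ∀ t, Tendsto (fun n : ℕ ↦ (n : ℝ)⁻¹ * ∑ j : Fin n, ⟪X j ω, t⟫ ^ 2) atTop
      (𝓝 (∫ ω, ⟪X 0 ω, t⟫ ^ 2 ∂P)) := by
  have hpair (a b : ι) : ∀ᵐ ω ∂P, Tendsto
      (fun n ↦ sampleMean (fun i ω ↦ X i ω a * X i ω b) n ω) atTop
      (𝓝 (secondMoment P (X 0) a b)) := by
    have hm : Measurable fun x : EuclideanSpace ℝ ι ↦ x a * x b := by fun_prop
    exact ae_tendsto_sampleMean (X := fun i ω ↦ X i ω a * X i ω b)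
      (hX_indep.comp (fun _ x ↦ x a * x b) fun _ ↦ hm) (fun i ↦ (hX_ident i).comp hm)
      (integrable_coord_mul_coord hX a b)
  filter_upwards [ae_all_iff.2 fun a ↦ ae_all_iff.2 fun b ↦ hpair a b] with ω hω t
  rw [integral_inner_sq_eq_sum hX]
  refine (tendsto_finsetSum _ fun a _ ↦ tendsto_finsetSum _ fun b _ ↦
    (hω a b).const_mul (t a * t b)).congr fun n ↦ ?_
  simp only [sampleMean, smul_eq_mul, inner_sq_eq_sum, Finset.mul_sum]
  rw [Finset.sum_comm (s := (Finset.univ : Finset (Fin n)))]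
  refine Finset.sum_congr rfl fun a _ ↦ ?_
  rw [Finset.sum_comm (s := (Finset.univ : Finset (Fin n)))]
  refine Finset.sum_congr rfl fun b _ ↦ Finset.sum_congr rfl fun j _ ↦ ?_
  ring

end

end BootstrapMeanTest

/-! ### Asymptotic level of the bootstrap test -/

open BootstrapMeanTest in
theorem proposition1 {d : ℕ}
    {Ω : Type*} [MeasurableSpace Ω] (P : Measure Ω) [IsProbabilityMeasure P]
    {Ω' : Type*} [MeasurableSpace Ω'] (P' : Measure Ω') [IsProbabilityMeasure P']
    (X : ℕ → Ω → EuclideanSpace ℝ (Fin d))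
    (hX_meas : ∀ i, Measurable (X i))
    (hX_indep : iIndepFun X P)
    (hX_ident : ∀ i, IdentDistrib (X i) (X 0) P P)
    (hX_sq : Integrable (fun ω => ‖X 0 ω‖ ^ 2) P)
    (hX_mean : ∫ ω, X 0 ω ∂P = 0)
    (hX_nondeg : ¬ ∀ᵐ ω ∂P, X 0 ω = 0)
    (I : (n : ℕ) → Fin n → Ω' → Fin n)
    (hI_meas : ∀ n k, Measurable (I n k))
    (hI_indep : ∀ n, iIndepFun (I n) P')
    (hI_unif : ∀ n (k j : Fin n), P'.real {ω' | I n k ω' = j} = 1 / (n : ℝ))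
    (α : ℝ) (hα : α ∈ Set.Ioo (0 : ℝ) 1) :
    Tendsto
      (fun n : ℕ => P.real {ω | BootstrapMeanTest.bootQuantile P' X I α n ω
        < BootstrapMeanTest.testStat X n ω})
      atTop (𝓝 α) := by
  have hL2 : MemLp (X 0) 2 P :=
    (memLp_two_iff_integrable_sq_norm (hX_meas 0).aestronglyMeasurable).2 hX_sq
  set ν := multivariateGaussian 0 (secondMoment P (X 0))
  have hν (r : ℝ) : ν {z | ‖z‖ ^ 2 = r} = 0 :=
    multivariateGaussian_setOf_norm_sq_eq (posSemidef_secondMoment hL2)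
      (secondMoment_ne_zero hL2 hX_nondeg) r
  have hνq := charFun_multivariateGaussian_secondMoment hL2
  have hF : ∀ᵐ ω ∂P, ∀ c, Tendsto (fun n ↦ bootCdf P' X I n ω c) atTop
      (𝓝 (ν.real {z | ‖z‖ ^ 2 ≤ c})) := by
    have hnm : Measurable fun x : EuclideanSpace ℝ (Fin d) ↦ ‖x‖ ^ 2 := by fun_prop
    filter_upwards [ae_tendsto_sampleMean hX_indep hX_ident (hL2.integrable one_le_two),
      ae_tendsto_mean_inner_sq hX_indep hX_ident hL2,
      ae_tendsto_sampleMean (X := fun i ω ↦ ‖X i ω‖ ^ 2)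
        (hX_indep.comp (fun _ x ↦ ‖x‖ ^ 2) fun _ ↦ hnm) (fun i ↦ (hX_ident i).comp hnm) hX_sq]
      with ω h1 h2 h3 c
    rw [hX_mean] at h1
    simp only [sampleMean, Fin.sum_univ_eq_sum_range (fun k ↦ ‖X k ω‖ ^ 2), smul_eq_mul] at h3
    exact tendsto_bootCdf hI_meas hI_indep hI_unif hν hνq h1 h3 h2 c
  have key := tendsto_measureReal_quantile_lt (P := P) (V := testStat X)
    (Q := bootQuantile P' X I α) (F := bootCdf P' X I) (p := 1 - α)
    ⟨by linarith [hα.2], by linarith [hα.1]⟩ (measurable_testStat hX_meas)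
    (tendsto_measureReal_testStat_le hX_meas hX_indep hX_ident hX_sq hX_mean hν hνq)
    (measurable_bootCdf hX_meas hI_meas) hF
    (fun r hr ↦ exists_measureReal_norm_sq_le_eq hν hr)
    (fun n ω c ↦ bootQuantile_le hα.2) (fun n ω c ↦ le_bootQuantile hα.1)
  rwa [sub_sub_cancel] at key
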